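/- Let $n\ge 1$ and $k\ge 1$, and let $G$ be a $k$-uniform hypergraph on $[n]=\{1,\dots,n\}$, i.e. a family of $k$-subsets of $[n]$. Let $X=(x_{i,j})_{1\le i,j\le n}$ be a matrix of $n^2$ independent variables, and let $C_k(X)$ be its $k$-th compound matrix over $\mathbb{Q}(x_{i,j})$: rows and columns are indexed by the $k$-subsets of $[n]$, and the $(S,T)$ entry is $\det(x_{i,j})_{i\in S,\,j\in T}$. For families $E_1,E_2$ of $k$-subsets of $[n]$, say that $E_1$ dominates $E_2$ if the submatrix of $C_k(X)$ with rows indexed by $E_2$ and columns indexed by $E_1$ has rank $|E_2|$. For $v\in[n]$, the (spanning) $k$-star with apex $v$ is the family $S_v$ of all $k$-subsets of $[n]$ that contain $v$. Let $K(G)$ be the simplicial complex on $[n]$ whose faces are the edges of $G$ and all subsets of $[n]$ with fewer than $k$ elements (the complete $(k-2)$-dimensional skeleton), and let $\tilde H_i(K(G);\mathbb{Q})$ denote its $i$-th reduced rational homology, where the empty set counts as a face of dimension $-1$. Then for every $v\in[n]$: (i) $G$ dominates the $k$-star $S_v$ if and only if $\tilde H_{k-2}(K(G);\mathbb{Q})=0$;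 (ii) the $k$-star $S_v$ dominates $G$ if and only if $\tilde H_{k-1}(K(G);\mathbb{Q})=0$. -/

import Mathlib

/-! ### Generic compound matrices and domination -/

/-- The field `ℚ(x_{ij})` of rational functions over `ℚ` in `n²` independent variables. -/
abbrev GenericField (n : ℕ) : Type :=
  FractionRing (MvPolynomial (Fin n × Fin n) ℚ)

/-- The `n × n` matrix `X = (x_{ij})` of independent variables, over `ℚ(x_{ij})`. -/
noncomputable def genericMatrix (n : ℕ) : Matrix (Fin n) (Fin n) (GenericField n) :=
  (Matrix.mvPolynomialX (Fin n) (Fin n) ℚ).map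
    (algebraMap (MvPolynomial (Fin n × Fin n) ℚ) (GenericField n))

/-- The `k`-th compound matrix of `A`: its rows and columns are indexed by the `k`-subsets of
`[n]`, and its `(S, T)` entry is the `k × k` minor of `A` with rows in `S` and columns in `T`
(both listed increasingly). -/
noncomputable def compoundMatrix {n : ℕ} {F : Type*} [CommRing F] (k : ℕ)
    (A : Matrix (Fin n) (Fin n) F) :
    Matrix (Set.powersetCard (Fin n) k) (Set.powersetCard (Fin n) k) F :=
  Matrix.of fun S T =>
    (A.submatrix ((S : Finset (Fin n)).orderEmbOfFin (Set.powersetCard.card_eq S))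
      ((T : Finset (Fin n)).orderEmbOfFin (Set.powersetCard.card_eq T))).det

/-- A `k`-uniform hypergraph on the vertex set `[n]`: a family of `k`-subsets of `[n]`. -/
abbrev UniformHypergraph (n k : ℕ) : Type :=
  Finset (Set.powersetCard (Fin n) k)

/-- `E₁` dominates `E₂` if the submatrix of the generic compound matrix `C_k(X)` with rows indexed
by `E₂` and columns indexed by `E₁` has rank `|E₂|`. -/
def Dominates {n k : ℕ} (E₁ E₂ : UniformHypergraph n k) : Prop :=
  ((compoundMatrix k (genericMatrix n)).submatrix
    (fun S : {S // S ∈ E₂} => S.1) (fun T : {T // T ∈ E₁} => T.1)).rank = E₂.card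

/-- The spanning `k`-star on `[n]` with apex `v`: all `k`-subsets of `[n]` containing `v`. -/
noncomputable def kStar {n : ℕ} (k : ℕ) (v : Fin n) : UniformHypergraph n k :=
  open Classical in Finset.univ.filter fun S => v ∈ (S : Finset (Fin n))

/-! ### Reduced simplicial homology -/

/-- The (augmented, ordered) simplicial boundary map on formal rational combinations of finite
sets: `∂ S = ∑_{x ∈ S} (-1)^{#{y ∈ S, y < x}} (S \ {x})`. In particular `∂ {x} = ∅`, `∂ ∅ = 0`. -/
noncomputable def simplicialBoundary (V : Type*) [LinearOrder V] :
    (Finset V →₀ ℚ) →ₗ[ℚ] (Finset V →₀ ℚ) :=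
  Finsupp.linearCombination ℚ fun S : Finset V =>
    ∑ x ∈ S, Finsupp.single (S.erase x) ((-1 : ℚ) ^ (S.filter (· < x)).card)

/-- The space `C_i(K)` of reduced rational `i`-chains of `K`: combinations of the faces of
dimension `i` (that is, with `i + 1` vertices). The empty set counts as a face of dimension `-1`.
(Mathlib's `PreAbstractSimplicialComplex` lists only the nonempty faces.) -/
def reducedChains {V : Type*} (K : PreAbstractSimplicialComplex V) (i : ℤ) :
    Submodule ℚ (Finset V →₀ ℚ) :=
  Finsupp.supported ℚ ℚ {S : Finset V | (S = ∅ ∨ S ∈ K.faces) ∧ (S.card : ℤ) = i + 1}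

/-- Reduced `i`-cycles. -/
noncomputable def reducedCycles {V : Type*} [LinearOrder V] (K : PreAbstractSimplicialComplex V)
    (i : ℤ) : Submodule ℚ (Finset V →₀ ℚ) :=
  reducedChains K i ⊓ LinearMap.ker (simplicialBoundary V)

/-- Reduced `i`-boundaries: the image of `C_{i+1}(K)`. -/
noncomputable def reducedBoundaries {V : Type*} [LinearOrder V]
    (K : PreAbstractSimplicialComplex V) (i : ℤ) : Submodule ℚ (Finset V →₀ ℚ) :=
  (reducedChains K (i + 1)).map (simplicialBoundary V)

theorem simplicialBoundary_single {V : Type*} [LinearOrder V] (S : Finset V) (c : ℚ) :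
    simplicialBoundary V (Finsupp.single S c) =
      ∑ x ∈ S, Finsupp.single (S.erase x) (c * (-1 : ℚ) ^ (S.filter (· < x)).card) := by
  simp [simplicialBoundary, Finsupp.linearCombination_single, Finset.smul_sum]

theorem simplicialBoundary_comp_self (V : Type*) [LinearOrder V] :
    simplicialBoundary V ∘ₗ simplicialBoundary V = 0 := by
  ext1 S
  ext1
  simp only [LinearMap.comp_apply, Finsupp.lsingle_apply, simplicialBoundary_single, map_sum,
    LinearMap.zero_apply, one_mul]
  rw [Finset.sum_sigma']
  refine Finset.sum_involution (fun p _ => ⟨p.2, p.1⟩) ?_ ?_ ?_ ?_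
  · rintro ⟨x, y⟩ h
    simp only [Finset.mem_sigma, Finset.mem_erase] at h
    obtain ⟨hx, hyx, hy⟩ := h
    have key : ∀ a b : V, a ∈ S → b ∈ S → a < b →
        (S.filter (· < b)).card = ((S.erase a).filter (· < b)).card + 1 ∧
        ((S.erase b).filter (· < a)).card = (S.filter (· < a)).card := by
      intro a b ha hb hab
      constructor
      · rw [Finset.filter_erase, Finset.card_erase_add_one (by simp [ha, hab])]
      · rw [Finset.filter_erase, Finset.erase_eq_of_notMem (by simp [hab.le])]
    simp only [Finset.erase_right_comm (a := y) (b := x), ← Finsupp.single_add]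
    rw [Finsupp.single_eq_zero]
    rcases lt_or_gt_of_ne hyx with hlt | hlt
    · obtain ⟨h1, h2⟩ := key y x hy hx hlt
      rw [h1, h2]; ring
    · obtain ⟨h1, h2⟩ := key x y hx hy hlt
      rw [h1, h2]; ring
  · rintro ⟨x, y⟩ h _ he
    simp only [Finset.mem_sigma, Finset.mem_erase] at h
    simp only [Sigma.mk.injEq] at he
    exact h.2.1 he.1
  · rintro ⟨x, y⟩ h
    simp only [Finset.mem_sigma, Finset.mem_erase] at h ⊢
    exact ⟨h.2.2, h.2.1.symm, h.1⟩
  · rintro ⟨x, y⟩ h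
    rfl

/-- Every boundary is a cycle, so that the quotient below is the usual one. -/
theorem reducedBoundaries_le_reducedCycles {V : Type*} [LinearOrder V]
    (K : PreAbstractSimplicialComplex V) (i : ℤ) :
    reducedBoundaries K i ≤ reducedCycles K i := by
  rw [reducedBoundaries, reducedChains, Finsupp.supported_eq_span_single, Submodule.map_span,
    Submodule.span_le]
  rintro _ ⟨_, ⟨S, ⟨hS, hc⟩, rfl⟩, rfl⟩
  refine ⟨?_, ?_⟩
  · rw [simplicialBoundary_single]
    refine Submodule.sum_mem _ fun x hx => Finsupp.single_mem_supported ℚ _ ⟨?_, ?_⟩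
    · rcases hS with rfl | hS
      · simp at hx
      · rcases (S.erase x).eq_empty_or_nonempty with h | h
        · exact Or.inl h
        · exact Or.inr ((K.isRelLowerSet_faces hS).2 (Finset.erase_subset x S) h)
    · have := Finset.card_erase_add_one hx
      omega
  · exact LinearMap.congr_fun (simplicialBoundary_comp_self V) _

/-- The `i`-th reduced rational homology `H̃_i(K; ℚ)`: reduced `i`-cycles modulo
reduced `i`-boundaries. -/
abbrev ReducedHomology {V : Type*} [LinearOrder V] (K : PreAbstractSimplicialComplex V)
    (i : ℤ) : Type _ :=
  reducedCycles K i ⧸ (reducedBoundaries K i).submoduleOf (reducedCycles K i)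

/-- The complex `K(G)` of a `k`-uniform hypergraph `G`: its faces are the edges of `G` and all the
sets of fewer than `k` vertices (the complete `(k-2)`-dimensional skeleton). -/
def hypergraphComplex {n k : ℕ} (G : UniformHypergraph n k) :
    PreAbstractSimplicialComplex (Fin n) where
  faces := {S | S.Nonempty ∧ (S.card < k ∨ ∃ e ∈ G, (e : Finset (Fin n)) = S)}
  isRelLowerSet_faces := by
    rintro S ⟨hne, hS⟩
    refine ⟨hne, fun T hTS hT => ⟨hT, ?_⟩⟩
    rcases hS with hS | ⟨e, he, rfl⟩
    · exact Or.inl ((Finset.card_le_card hTS).trans_lt hS)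
    · rcases eq_or_ne T (e : Finset (Fin n)) with rfl | hne'
      · exact Or.inr ⟨e, he, rfl⟩
      · left
        have h := Finset.card_lt_card (Finset.ssubset_iff_subset_ne.2 ⟨hTS, hne'⟩)
        rwa [Set.powersetCard.card_eq] at h

/-! Expand a minor of `X` with columns `T ∋ v` along the column `v`. Up to sign, the coefficient of
the complementary minor at `S \ {x}` is the boundary sign times `x_{x,v}`, and `x_{x,v}` is the
quotient of the products of column `v` over `S` and over `S \ {x}`. So the star columns of `C_k(X)`
form a product `D ∂ H`, with `D` diagonal and invertible and `∂` the boundary matrix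
(`compoundMatrix_submatrix_kStar`).

These columns are independent because `C_k(X)` is invertible, while `∂` has rank at most `|S_v|`,
the dimension of the `(k-2)`-cycles of the full skeleton. Hence `D ∂ H` and `D ∂` have the same
column space, and any choice of rows `G` gives equal ranks: the block with rows `G` and columns
`S_v` has rank `dim B_{k-2}(K(G))` (`rank_compoundMatrix_submatrix_kStar`). This is `|G|` iff `∂` is
injective on the chains of `G`, and `|S_v|` iff every `(k-2)`-cycle bounds. Transposing `X`
interchanges the roles of rows and columns. -/

/-! ### Rank under field extension and row selection -/

namespace Matrix

/-- The rank of a matrix over a field does not change under field extension. -/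
theorem rank_map_algebraMap {K L m n : Type*} [Field K] [Field L] [Algebra K L] [Fintype m]
    [Fintype n] (M : Matrix m n K) : (M.map (algebraMap K L)).rank = M.rank := by
  classical
  obtain ⟨κ, f, hf, hspan, hli⟩ := exists_linearIndependent' K M.row
  have : Finite κ := Finite.of_injective f hf
  have := Fintype.ofFinite κ
  have hrank : M.rank = Fintype.card κ := by
    rw [rank_eq_finrank_span_row, ← hspan, finrank_span_eq_card hli]
  rw [hrank]
  apply le_antisymm
  -- Factoring `M` through a row basis over `K` bounds the rank over `L` too.
  · have hmem : ∀ i, ∃ c : κ → K, ∑ j, c j • M (f j) = M i := fun i => by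
      have h : M.row i ∈ Submodule.span K (Set.range (M.row ∘ f)) := by
        rw [hspan]; exact Submodule.subset_span ⟨i, rfl⟩
      exact (Submodule.mem_span_range_iff_exists_fun K).1 h
    choose c hc using hmem
    have hM : M = Matrix.of c * M.submatrix f id := by
      ext i j
      simp [← hc i, Matrix.mul_apply]
    rw [hM, Matrix.map_mul]
    exact (rank_mul_le_left _ _).trans (rank_le_card_width _)
  · have h : LinearIndependent L ((M.map (algebraMap K L)).submatrix f id).row :=
      linearIndependent_algebraMap_comp_iff.2 hli
    rw [← h.rank_matrix]
    exact rank_submatrix_le _ _ _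

theorem range_mulVecLin_submatrix_left {K l m n : Type*} [CommSemiring K] [Fintype n]
    (M : Matrix m n K) (f : l → m) : LinearMap.range (M.submatrix f id).mulVecLin =
      (LinearMap.range M.mulVecLin).map (LinearMap.funLeft K K f) := by
  rw [← LinearMap.range_comp]
  congr 1

/-- If multiplying `M` on the right by `H` preserves its rank, the same holds for each matrix
of rows of `M`. -/
theorem rank_submatrix_mul_of_rank_mul_eq {K l m n o : Type*} [Field K] [Fintype l] [Fintype m]
    [Fintype n] [Fintype o]
    (M : Matrix m n K) (H : Matrix n o K) (h : (M * H).rank = M.rank) (f : l → m) :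
    ((M * H).submatrix f id).rank = (M.submatrix f id).rank := by
  classical
  have hrange : LinearMap.range (M * H).mulVecLin = LinearMap.range M.mulVecLin := by
    apply Submodule.eq_of_le_of_finrank_eq
    · rw [mulVecLin_mul]
      exact LinearMap.range_comp_le_range _ _
    · exact h
  unfold Matrix.rank
  rw [range_mulVecLin_submatrix_left, hrange, ← range_mulVecLin_submatrix_left]

end Matrix

/-! ### Minors and compound matrices -/

section Minors

open Matrix

theorem Finset.card_filter_lt_orderEmbOfFin {α : Type*} [LinearOrder α] {S : Finset α} {m : ℕ}
    (h : S.card = m) (i : Fin m) : (S.filter (· < S.orderEmbOfFin h i)).card = i := by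
  have : S.filter (· < S.orderEmbOfFin h i) =
      (Finset.Iio i).map (S.orderEmbOfFin h).toEmbedding := by
    ext x
    constructor
    · intro hx
      obtain ⟨hxS, hlt⟩ := Finset.mem_filter.1 hx
      rw [← Finset.map_orderEmbOfFin_univ S h] at hxS
      obtain ⟨j, -, rfl⟩ := Finset.mem_map.1 hxS
      exact Finset.mem_map_of_mem _ (Finset.mem_Iio.2 ((S.orderEmbOfFin h).lt_iff_lt.1 hlt))
    · intro hx
      obtain ⟨j, hj, rfl⟩ := Finset.mem_map.1 hx
      exact Finset.mem_filter.2 ⟨Finset.orderEmbOfFin_mem _ _ _,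
        (S.orderEmbOfFin h).lt_iff_lt.2 (Finset.mem_Iio.1 hj)⟩
  rw [this, Finset.card_map, Fin.card_Iio]

theorem Finset.orderEmbOfFin_erase {α : Type*} [LinearOrder α] {S : Finset α} {m : ℕ}
    (h : S.card = m + 1) (i : Fin (m + 1)) (h' : (S.erase (S.orderEmbOfFin h i)).card = m) :
    ((S.erase (S.orderEmbOfFin h i)).orderEmbOfFin h' : Fin m → α) =
      S.orderEmbOfFin h ∘ i.succAbove := by
  symm
  apply Finset.orderEmbOfFin_unique
  · intro x
    simp [Fin.succAbove_ne]
  · exact (S.orderEmbOfFin h).strictMono.comp (Fin.strictMono_succAbove i)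

/-- The `m × m` minor of `A` with rows in `S` and columns in `T`, or `0` if one of these sets
does not have `m` elements. -/
noncomputable def setMinor {n : ℕ} {F : Type*} [CommRing F] (A : Matrix (Fin n) (Fin n) F)
    (m : ℕ) (S T : Finset (Fin n)) : F :=
  if h : S.card = m ∧ T.card = m then
    (A.submatrix (S.orderEmbOfFin h.1) (T.orderEmbOfFin h.2)).det else 0

/-- Laplace expansion of a minor along the column `v`. -/
theorem setMinor_succ_column {n : ℕ} {F : Type*} [CommRing F] (A : Matrix (Fin n) (Fin n) F)
    {m : ℕ} {S T : Finset (Fin n)} (hS : S.card = m + 1) (hT : T.card = m + 1) {v : Fin n}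
    (hv : v ∈ T) :
    setMinor A (m + 1) S T = ∑ x ∈ S, (-1 : F) ^ (S.filter (· < x)).card * A x v *
      ((-1) ^ (T.filter (· < v)).card * setMinor A m (S.erase x) (T.erase v)) := by
  obtain ⟨j, rfl⟩ : ∃ j, T.orderEmbOfFin hT j = v := by
    rw [← Finset.map_orderEmbOfFin_univ T hT] at hv
    obtain ⟨j, -, hj⟩ := Finset.mem_map.1 hv
    exact ⟨j, hj⟩
  rw [setMinor, dif_pos ⟨hS, hT⟩, det_succ_column _ j, ← Finset.sum_coe_sort S,
    ← (S.orderIsoOfFin hS).toEquiv.sum_comp]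
  refine Finset.sum_congr rfl fun i _ => ?_
  have hi : (((S.orderIsoOfFin hS).toEquiv i : S) : Fin n) = S.orderEmbOfFin hS i := rfl
  have h1 : (S.erase (S.orderEmbOfFin hS i)).card = m := by
    rw [Finset.card_erase_of_mem (Finset.orderEmbOfFin_mem _ _ _), hS, Nat.add_sub_cancel]
  have h2 : (T.erase (T.orderEmbOfFin hT j)).card = m := by
    rw [Finset.card_erase_of_mem (Finset.orderEmbOfFin_mem _ _ _), hT, Nat.add_sub_cancel]
  rw [hi, setMinor, dif_pos ⟨h1, h2⟩, Finset.card_filter_lt_orderEmbOfFin,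
    Finset.card_filter_lt_orderEmbOfFin, Finset.orderEmbOfFin_erase,
    Finset.orderEmbOfFin_erase, submatrix_submatrix, submatrix_apply, pow_add]
  ring

theorem compoundMatrix_apply {n : ℕ} {F : Type*} [CommRing F] (k : ℕ)
    (A : Matrix (Fin n) (Fin n) F) (S T : Set.powersetCard (Fin n) k) :
    compoundMatrix k A S T = setMinor A k S T := by
  rw [setMinor, dif_pos ⟨Set.powersetCard.card_eq S, Set.powersetCard.card_eq T⟩]
  rfl

theorem compoundMatrix_transpose {n : ℕ} {F : Type*} [CommRing F] (k : ℕ)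
    (A : Matrix (Fin n) (Fin n) F) : compoundMatrix k Aᵀ = (compoundMatrix k A)ᵀ := by
  ext S T
  simp only [compoundMatrix, of_apply, transpose_apply]
  rw [← det_transpose, transpose_submatrix, transpose_transpose]

theorem compoundMatrix_map {n : ℕ} {R F : Type*} [CommRing R] [CommRing F] (f : R →+* F) (k : ℕ)
    (A : Matrix (Fin n) (Fin n) R) : compoundMatrix k (A.map f) = (compoundMatrix k A).map f := by
  ext S T
  simp only [compoundMatrix, of_apply, map_apply, RingHom.map_det, RingHom.mapMatrix_apply,
    submatrix_map]

theorem compoundMatrix_one {n : ℕ} {F : Type*} [CommRing F] (k : ℕ) :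
    compoundMatrix k (1 : Matrix (Fin n) (Fin n) F) = 1 := by
  ext S T
  simp only [compoundMatrix, of_apply]
  rcases eq_or_ne S T with rfl | hST
  · rw [submatrix_one _ (RelEmbedding.injective _), det_one, one_apply_eq]
  · rw [one_apply_ne hST]
    obtain ⟨x, hxS, hxT⟩ := (Set.powersetCard.exists_mem_notMem_iff_ne S T).1 hST
    have hx : x ∈ Set.range ((S : Finset (Fin n)).orderEmbOfFin
        (Set.powersetCard.card_eq S)) := by
      rw [Finset.range_orderEmbOfFin]; exact hxS
    obtain ⟨i, rfl⟩ := hx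
    refine det_eq_zero_of_row_eq_zero i fun j => ?_
    rw [submatrix_apply, one_apply_ne]
    intro h
    rw [h] at hxT
    exact hxT (Finset.orderEmbOfFin_mem _ _ _)

/-- The determinant is a polynomial in the variables, and specializing `X` to the identity gives
`1`. -/
theorem det_compoundMatrix_genericMatrix_ne_zero (n k : ℕ) :
    (compoundMatrix k (genericMatrix n)).det ≠ 0 := by
  rw [genericMatrix, compoundMatrix_map, ← RingHom.mapMatrix_apply, ← RingHom.map_det]
  refine (map_ne_zero_iff _ (IsFractionRing.injective _ _)).2 fun h => ?_
  have h' := congrArg (MvPolynomial.eval fun p : Fin n × Fin n =>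
    (1 : Matrix (Fin n) (Fin n) ℚ) p.1 p.2) h
  rw [RingHom.map_det, RingHom.mapMatrix_apply, ← compoundMatrix_map] at h'
  have h1 : (mvPolynomialX (Fin n) (Fin n) ℚ).map (MvPolynomial.eval fun p : Fin n × Fin n =>
      (1 : Matrix (Fin n) (Fin n) ℚ) p.1 p.2) = 1 := by
    ext i j; simp
  rw [h1, compoundMatrix_one, det_one, map_zero] at h'
  exact one_ne_zero h'

theorem genericMatrix_apply_ne_zero {n : ℕ} (i j : Fin n) : genericMatrix n i j ≠ 0 := by
  rw [genericMatrix, map_apply]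
  exact (map_ne_zero_iff _ (IsFractionRing.injective _ _)).2
    (by simp)

end Minors

/-! ### Boundary matrix, cycles and homology of `K(G)` -/

section Boundary

open Matrix

/-- The matrix of the boundary map: the row of a `k`-set is its boundary. -/
noncomputable def boundaryMatrix (n k : ℕ) :
    Matrix (Set.powersetCard (Fin n) k) (Finset (Fin n)) ℚ :=
  Matrix.of fun S U => simplicialBoundary (Fin n) (Finsupp.single (S : Finset (Fin n)) 1) U

theorem boundaryMatrix_apply {n k : ℕ} (S : Set.powersetCard (Fin n) k) (U : Finset (Fin n)) :
    boundaryMatrix n k S U = ∑ x ∈ (S : Finset (Fin n)),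
      if (S : Finset (Fin n)).erase x = U then
        (-1 : ℚ) ^ ((S : Finset (Fin n)).filter (· < x)).card else 0 := by
  simp only [boundaryMatrix, of_apply, simplicialBoundary_single, Finsupp.finsetSum_apply,
    Finsupp.single_apply, one_mul]

/-- Among the facets of `S`, only the one opposite `v` avoids `v`, and it determines `S`. -/
theorem simplicialBoundary_single_apply_erase {V : Type*} [LinearOrder V] {S T : Finset V} {v : V}
    (hS : v ∈ S) (hT : v ∈ T) (c : ℚ) :
    simplicialBoundary V (Finsupp.single S c) (T.erase v) =
      Finsupp.single S c T * (-1 : ℚ) ^ (T.filter (· < v)).card := by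
  rw [simplicialBoundary_single, Finsupp.finsetSum_apply, Finset.sum_eq_single_of_mem v hS]
  · by_cases h : S = T
    · subst h; simp
    · rw [Finsupp.single_eq_of_ne, Finsupp.single_eq_of_ne (Ne.symm h), zero_mul]
      intro h'
      exact h (by rw [← Finset.insert_erase hS, ← h', Finset.insert_erase hT])
  · intro x _ hx
    rw [Finsupp.single_eq_of_ne]
    intro h'
    have : v ∈ S.erase x := Finset.mem_erase.2 ⟨hx.symm, hS⟩
    rw [← h'] at this
    simp at this

/-- A cycle all of whose faces contain a given vertex vanishes. -/
theorem disjoint_supported_ker_simplicialBoundary {V : Type*} [LinearOrder V] (v : V)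
    {s : Set (Finset V)} (hs : ∀ S ∈ s, v ∈ S) :
    Disjoint (Finsupp.supported ℚ ℚ s) (LinearMap.ker (simplicialBoundary V)) := by
  rw [Submodule.disjoint_def]
  intro z hz hker
  have key : ∀ T, v ∈ T → simplicialBoundary V z (T.erase v) =
      z T * (-1 : ℚ) ^ (T.filter (· < v)).card := by
    intro T hT
    have hsum : z = z.sum Finsupp.single := z.sum_single.symm
    conv_lhs => rw [hsum, Finsupp.sum, map_sum, Finsupp.finsetSum_apply]
    conv_rhs => rw [hsum, Finsupp.sum, Finsupp.finsetSum_apply, Finset.sum_mul]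
    exact Finset.sum_congr rfl fun S hS =>
      simplicialBoundary_single_apply_erase (hs S (hz hS)) hT _
  ext T
  by_cases hT : v ∈ T
  · have h := key T hT
    rw [LinearMap.mem_ker.1 hker] at h
    simpa using h
  · by_contra h
    exact hT (hs T (hz (Finsupp.mem_support_iff.2 h)))

theorem finrank_supported {α : Type*} [Finite α] (s : Set α) :
    Module.finrank ℚ (Finsupp.supported ℚ ℚ s) = s.ncard := by
  have := Fintype.ofFinite s
  rw [(Finsupp.supportedEquivFinsupp s).finrank_eq, Module.finrank_finsupp_self,
    ← Nat.card_eq_fintype_card, Nat.card_coe_set_eq]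

theorem finrank_supported_image_val {n k : ℕ} (G : UniformHypergraph n k) :
    Module.finrank ℚ (Finsupp.supported ℚ ℚ
      (Subtype.val '' (G : Set (Set.powersetCard (Fin n) k)))) = G.card := by
  rw [finrank_supported, Set.ncard_image_of_injective _ Subtype.val_injective,
    Set.ncard_coe_finset]

theorem mem_kStar {n k : ℕ} {v : Fin n} {S : Set.powersetCard (Fin n) k} :
    S ∈ kStar k v ↔ v ∈ (S : Finset (Fin n)) := by
  simp [kStar]

theorem reducedChains_hypergraphComplex_top {n m : ℕ} (G : UniformHypergraph n (m + 1)) :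
    reducedChains (hypergraphComplex G) m = Finsupp.supported ℚ ℚ
      (Subtype.val '' (G : Set (Set.powersetCard (Fin n) (m + 1)))) := by
  unfold reducedChains
  congr 1
  ext S
  simp only [Set.mem_ofPred_eq, Set.mem_image, Finset.mem_coe, hypergraphComplex]
  constructor
  · rintro ⟨rfl | ⟨-, h | ⟨e, he, rfl⟩⟩, hc⟩
    · simp at hc; omega
    · omega
    · exact ⟨e, he, rfl⟩
  · rintro ⟨e, he, rfl⟩
    have hc := Set.powersetCard.card_eq e
    refine ⟨Or.inr ⟨?_, Or.inr ⟨e, he, rfl⟩⟩, by omega⟩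
    rw [← Finset.card_pos]; omega

theorem reducedChains_hypergraphComplex_above {n m : ℕ} (G : UniformHypergraph n (m + 1)) :
    reducedChains (hypergraphComplex G) (m + 1) = ⊥ := by
  refine Eq.trans ?_ Finsupp.supported_empty
  unfold reducedChains
  congr 1
  rw [Set.eq_empty_iff_forall_notMem]
  rintro S ⟨rfl | ⟨-, h | ⟨e, he, rfl⟩⟩, hc⟩
  · simp at hc; omega
  · omega
  · have := Set.powersetCard.card_eq e
    omega

theorem reducedChains_hypergraphComplex_below {n m : ℕ} (G : UniformHypergraph n (m + 1)) :
    reducedChains (hypergraphComplex G) ((m : ℤ) - 1) =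
      Finsupp.supported ℚ ℚ {S : Finset (Fin n) | S.card = m} := by
  unfold reducedChains
  congr 1
  ext S
  simp only [Set.mem_ofPred_eq, hypergraphComplex]
  constructor
  · rintro ⟨-, hc⟩
    omega
  · intro hc
    refine ⟨?_, by omega⟩
    -- For `m = 0` the only face here is the empty one, of dimension `-1`.
    rcases S.eq_empty_or_nonempty with h | h
    · exact Or.inl h
    · exact Or.inr ⟨h, Or.inl (by omega)⟩

theorem reducedBoundaries_hypergraphComplex {n m : ℕ} (G : UniformHypergraph n (m + 1)) :
    reducedBoundaries (hypergraphComplex G) ((m : ℤ) - 1) = (Finsupp.supported ℚ ℚ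
      (Subtype.val '' (G : Set (Set.powersetCard (Fin n) (m + 1))))).map
        (simplicialBoundary (Fin n)) := by
  rw [reducedBoundaries, sub_add_cancel, reducedChains_hypergraphComplex_top]

theorem rank_boundaryMatrix_submatrix {n m : ℕ} (G : UniformHypergraph n (m + 1)) :
    ((boundaryMatrix n (m + 1)).submatrix (Subtype.val : {S // S ∈ G} → _) id).rank =
      Module.finrank ℚ (reducedBoundaries (hypergraphComplex G) ((m : ℤ) - 1)) := by
  rw [rank_eq_finrank_span_row, reducedBoundaries_hypergraphComplex,
    Finsupp.supported_eq_span_single, Submodule.map_span,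
    ← (Finsupp.linearEquivFunOnFinite ℚ ℚ (Finset (Fin n))).finrank_map_eq, Submodule.map_span]
  have hrange : Set.range ((boundaryMatrix n (m + 1)).submatrix
      (Subtype.val : {S // S ∈ G} → _) id).row =
      ⇑(Finsupp.linearEquivFunOnFinite ℚ ℚ (Finset (Fin n))).toLinearMap ''
        (⇑(simplicialBoundary (Fin n)) '' ((fun i => Finsupp.single i 1) ''
          (Subtype.val '' (G : Set (Set.powersetCard (Fin n) (m + 1)))))) := by
    ext f
    rw [Set.image_image, Set.image_image, Set.image_image]
    constructor
    · rintro ⟨S, rfl⟩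
      exact ⟨S.1, S.2, rfl⟩
    · rintro ⟨S, hS, rfl⟩
      exact ⟨⟨S, hS⟩, rfl⟩
  rw [hrange]

theorem card_kStar {n m : ℕ} (v : Fin n) :
    (kStar (m + 1) v).card = {S : Finset (Fin n) | S.card = m ∧ v ∉ S}.ncard := by
  rw [← Set.ncard_coe_finset]
  refine Set.ncard_congr (fun S _ => (S : Finset (Fin n)).erase v) ?_ ?_ ?_
  · intro S hS
    have hc := Set.powersetCard.card_eq S
    exact ⟨by rw [Finset.card_erase_of_mem (mem_kStar.1 hS), hc, Nat.add_sub_cancel], by simp⟩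
  · intro S T hS hT h
    apply Subtype.ext
    rw [← Finset.insert_erase (mem_kStar.1 hS), ← Finset.insert_erase (mem_kStar.1 hT), h]
  · rintro U ⟨hU, hv⟩
    exact ⟨⟨insert v U, by rw [Set.powersetCard.mem_iff, Finset.card_insert_of_notMem hv, hU]⟩,
      mem_kStar.2 (Finset.mem_insert_self _ _), Finset.erase_insert hv⟩

theorem finrank_map_of_disjoint_ker {K V W : Type*} [Field K] [AddCommGroup V] [Module K V]
    [AddCommGroup W] [Module K W] (f : V →ₗ[K] W) {p : Submodule K V}
    (h : Disjoint p (LinearMap.ker f)) :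
    Module.finrank K (p.map f) = Module.finrank K p := by
  rw [← LinearMap.range_domRestrict]
  refine LinearMap.finrank_range_of_inj ?_
  rw [← LinearMap.ker_eq_bot, LinearMap.ker_domRestrict, ← Submodule.disjoint_iff_comap_eq_bot]
  exact h

/-- Upper bound: cycles meet the chains on `m`-sets containing `v` trivially, leaving room only for
the `m`-sets avoiding `v`. Lower bound: the boundaries of the star's edges are independent cycles,
and the cycle space in this degree does not depend on `G`. -/
theorem finrank_reducedCycles_hypergraphComplex {n m : ℕ} (G : UniformHypergraph n (m + 1))
    (v : Fin n) :
    Module.finrank ℚ (reducedCycles (hypergraphComplex G) ((m : ℤ) - 1)) =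
      (kStar (m + 1) v).card := by
  apply le_antisymm
  · set W := Finsupp.supported ℚ ℚ {S : Finset (Fin n) | S.card = m ∧ v ∈ S}
    have hW : Module.finrank ℚ W = {S : Finset (Fin n) | S.card = m ∧ v ∈ S}.ncard :=
      finrank_supported _
    have hdisj : reducedCycles (hypergraphComplex G) ((m : ℤ) - 1) ⊓ W = ⊥ :=
      ((disjoint_supported_ker_simplicialBoundary v fun S hS => hS.2).symm.mono_left
        inf_le_right).eq_bot
    have hle : reducedCycles (hypergraphComplex G) ((m : ℤ) - 1) ⊔ W ≤
        Finsupp.supported ℚ ℚ {S : Finset (Fin n) | S.card = m} := by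
      refine sup_le ?_ (Finsupp.supported_mono fun S hS => hS.1)
      rw [← reducedChains_hypergraphComplex_below G]
      exact inf_le_left
    have h1 := Submodule.finrank_sup_add_finrank_inf_eq
      (reducedCycles (hypergraphComplex G) ((m : ℤ) - 1)) W
    have h2 := Submodule.finrank_mono hle
    rw [finrank_supported] at h2
    have h3 : {S : Finset (Fin n) | S.card = m} ⊆
        {S | S.card = m ∧ v ∈ S} ∪ {S | S.card = m ∧ v ∉ S} := fun S hS => by
      by_cases hv : v ∈ S
      · exact Or.inl ⟨hS, hv⟩
      · exact Or.inr ⟨hS, hv⟩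
    have h4 := (Set.ncard_le_ncard h3).trans (Set.ncard_union_le _ _)
    rw [hdisj, finrank_bot] at h1
    rw [card_kStar]
    omega
  · have hcyc : reducedCycles (hypergraphComplex G) ((m : ℤ) - 1) =
        reducedCycles (hypergraphComplex (kStar (m + 1) v)) ((m : ℤ) - 1) := by
      rw [reducedCycles, reducedCycles, reducedChains_hypergraphComplex_below,
        reducedChains_hypergraphComplex_below]
    have h := Submodule.finrank_mono (reducedBoundaries_le_reducedCycles
      (hypergraphComplex (kStar (m + 1) v)) ((m : ℤ) - 1))
    rwa [reducedBoundaries_hypergraphComplex, finrank_map_of_disjoint_ker,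
      finrank_supported_image_val, ← hcyc] at h
    refine disjoint_supported_ker_simplicialBoundary v ?_
    rintro _ ⟨S, hS, rfl⟩
    exact mem_kStar.1 hS

/-- The first homology group in question vanishes if and only if the boundaries have the dimension
of the space of cycles of the complete complex. -/
theorem subsingleton_reducedHomology_below_iff {n m : ℕ} (G : UniformHypergraph n (m + 1))
    (v : Fin n) :
    Subsingleton (ReducedHomology (hypergraphComplex G) ((m : ℤ) - 1)) ↔
      Module.finrank ℚ (reducedBoundaries (hypergraphComplex G) ((m : ℤ) - 1)) =
        (kStar (m + 1) v).card := by
  have hle := reducedBoundaries_le_reducedCycles (hypergraphComplex G) ((m : ℤ) - 1)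
  rw [Submodule.Quotient.subsingleton_iff, Submodule.submoduleOf_eq_top,
    ← finrank_reducedCycles_hypergraphComplex G v]
  exact ⟨fun h => by rw [le_antisymm hle h],
    fun h => (Submodule.eq_of_le_of_finrank_eq hle h).ge⟩

/-- The top homology group vanishes if and only if the boundaries of the edges are linearly
independent. -/
theorem subsingleton_reducedHomology_top_iff {n m : ℕ} (G : UniformHypergraph n (m + 1)) :
    Subsingleton (ReducedHomology (hypergraphComplex G) m) ↔
      Module.finrank ℚ (reducedBoundaries (hypergraphComplex G) ((m : ℤ) - 1)) = G.card := by
  rw [Submodule.Quotient.subsingleton_iff, Submodule.submoduleOf_eq_top, reducedBoundaries,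
    reducedChains_hypergraphComplex_above, Submodule.map_bot, le_bot_iff, reducedCycles,
    reducedChains_hypergraphComplex_top, reducedBoundaries_hypergraphComplex]
  set p := Finsupp.supported ℚ ℚ (Subtype.val '' (G : Set (Set.powersetCard (Fin n) (m + 1))))
    with hp
  rw [← finrank_supported_image_val G, ← hp, ← LinearMap.range_domRestrict, ← disjoint_iff,
    Submodule.disjoint_iff_comap_eq_bot, ← LinearMap.ker_domRestrict]
  -- By rank-nullity, a full-dimensional image means no nonzero cycle.
  have h := ((simplicialBoundary (Fin n)).domRestrict p).finrank_range_add_finrank_ker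
  rw [← Submodule.finrank_eq_zero (R := ℚ)]
  omega

end Boundary

/-! ### Ranks of the star blocks of the compound matrix -/

section Domination

open Matrix

theorem rank_boundaryMatrix_le {n m : ℕ} (v : Fin n) :
    (boundaryMatrix n (m + 1)).rank ≤ (kStar (m + 1) v).card := by
  have h := rank_boundaryMatrix_submatrix (n := n) (m := m) Finset.univ
  rw [← finrank_reducedCycles_hypergraphComplex Finset.univ v]
  refine le_trans (le_of_eq ?_)
    (Submodule.finrank_mono (reducedBoundaries_le_reducedCycles _ _))
  rw [← h]
  exact ((boundaryMatrix n (m + 1)).rank_submatrix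
    (Equiv.subtypeUnivEquiv Finset.mem_univ) (Equiv.refl _)).symm

/-- The columns of a compound matrix indexed by the `k`-star with apex `v` factor through the
boundary matrix. -/
theorem compoundMatrix_submatrix_kStar {n m : ℕ} {F : Type*} [Field F] [Algebra ℚ F]
    (A : Matrix (Fin n) (Fin n) F) (v : Fin n) (hv : ∀ i, A i v ≠ 0) :
    (compoundMatrix (m + 1) A).submatrix id (Subtype.val : {T // T ∈ kStar (m + 1) v} → _) =
      (diagonal (fun S : Set.powersetCard (Fin n) (m + 1) => ∏ x ∈ (S : Finset (Fin n)), A x v) *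
        (boundaryMatrix n (m + 1)).map (algebraMap ℚ F)) *
      Matrix.of fun (U : Finset (Fin n)) (T : {T // T ∈ kStar (m + 1) v}) => (∏ x ∈ U, A x v)⁻¹ *
        ((-1) ^ ((T.1 : Finset (Fin n)).filter (· < v)).card *
          setMinor A m U ((T.1 : Finset (Fin n)).erase v)) := by
  ext S T
  have hvT := mem_kStar.1 T.2
  rw [submatrix_apply, id, compoundMatrix_apply, setMinor_succ_column A
    (Set.powersetCard.card_eq S) (Set.powersetCard.card_eq T.1) hvT, Matrix.mul_assoc,
    diagonal_mul, Matrix.mul_apply]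
  simp only [map_apply, boundaryMatrix_apply, map_sum, Finset.sum_mul, of_apply]
  rw [Finset.sum_comm, Finset.mul_sum]
  refine Finset.sum_congr rfl fun x hx => ?_
  rw [Finset.sum_eq_single_of_mem _ (Finset.mem_univ ((S : Finset (Fin n)).erase x))]
  -- The product over `S` divided by that over `S.erase x` leaves the Laplace coefficient `A x v`.
  · rw [if_pos rfl, ← Finset.mul_prod_erase _ _ hx]
    have : ∏ x ∈ (S : Finset (Fin n)).erase x, A x v ≠ 0 :=
      Finset.prod_ne_zero_iff.2 fun i _ => hv i
    simp only [map_pow, map_neg, map_one]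
    field_simp
  · intro U _ hU
    rw [if_neg hU.symm, map_zero, zero_mul]

theorem rank_compoundMatrix_submatrix_kStar {n m : ℕ} {F : Type*} [Field F] [Algebra ℚ F]
    (A : Matrix (Fin n) (Fin n) F) (hA : (compoundMatrix (m + 1) A).det ≠ 0) (v : Fin n)
    (hv : ∀ i, A i v ≠ 0) (G : UniformHypergraph n (m + 1)) :
    ((compoundMatrix (m + 1) A).submatrix (fun S : {S // S ∈ G} => S.1)
      (fun T : {T // T ∈ kStar (m + 1) v} => T.1)).rank =
      Module.finrank ℚ (reducedBoundaries (hypergraphComplex G) ((m : ℤ) - 1)) := by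
  have hfac := compoundMatrix_submatrix_kStar (m := m) A v hv
  set d := fun S : Set.powersetCard (Fin n) (m + 1) => ∏ x ∈ (S : Finset (Fin n)), A x v
  have hd : ∀ S, d S ≠ 0 := fun S => Finset.prod_ne_zero_iff.2 fun i _ => hv i
  set M := diagonal d * (boundaryMatrix n (m + 1)).map (algebraMap ℚ F)
  have hM : M.rank ≤ (kStar (m + 1) v).card := by
    rw [rank_mul_eq_right_of_det_ne_zero _ _
      (by rw [det_diagonal]; exact Finset.prod_ne_zero_iff.2 fun S _ => hd S),
      rank_map_algebraMap]
    exact rank_boundaryMatrix_le v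
  have hC : ((compoundMatrix (m + 1) A).submatrix id
      (Subtype.val : {T // T ∈ kStar (m + 1) v} → _)).rank = (kStar (m + 1) v).card := by
    have hli : LinearIndependent F ((compoundMatrix (m + 1) A).submatrix id
        (Subtype.val : {T // T ∈ kStar (m + 1) v} → _))ᵀ.row :=
      (linearIndependent_cols_of_det_ne_zero hA).comp _ Subtype.val_injective
    rw [← rank_transpose, hli.rank_matrix, Fintype.card_coe]
  rw [hfac] at hC
  -- The bounds `hM` and `hC` pinch: the right factor costs no rank, so it can be dropped on the
  -- rows in `G`.
  have key := rank_submatrix_mul_of_rank_mul_eq M _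
    (le_antisymm (rank_mul_le_left _ _) (hM.trans hC.ge)) (Subtype.val : {S // S ∈ G} → _)
  rw [← hfac] at key
  have hMG : M.submatrix (Subtype.val : {S // S ∈ G} → _) id =
      diagonal (fun S : {S // S ∈ G} => d S.1) *
        ((boundaryMatrix n (m + 1)).submatrix (Subtype.val : {S // S ∈ G} → _) id).map
          (algebraMap ℚ F) := by
    ext S U
    simp [M, diagonal_mul]
  rw [hMG, rank_mul_eq_right_of_det_ne_zero _ _
      (by rw [det_diagonal]; exact Finset.prod_ne_zero_iff.2 fun S _ => hd _),
      rank_map_algebraMap, rank_boundaryMatrix_submatrix] at key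
  exact key

end Domination

theorem proposition2p4 {n k : ℕ} (hk : 1 ≤ k) (G : UniformHypergraph n k) (v : Fin n) :
    (Dominates G (kStar k v) ↔
      Subsingleton (ReducedHomology (hypergraphComplex G) ((k : ℤ) - 2))) ∧
    (Dominates (kStar k v) G ↔
      Subsingleton (ReducedHomology (hypergraphComplex G) ((k : ℤ) - 1))) := by
  obtain ⟨m, rfl⟩ := Nat.exists_eq_add_of_le' hk
  have h1 : ((m + 1 : ℕ) : ℤ) - 2 = (m : ℤ) - 1 := by push_cast; ring
  have h2 : ((m + 1 : ℕ) : ℤ) - 1 = (m : ℤ) := by push_cast; ring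
  have hdet := det_compoundMatrix_genericMatrix_ne_zero n (m + 1)
  rw [h1, h2, subsingleton_reducedHomology_below_iff G v,
    subsingleton_reducedHomology_top_iff, Dominates, Dominates,
    rank_compoundMatrix_submatrix_kStar _ hdet v fun i => genericMatrix_apply_ne_zero i v,
    -- In (i) the star indexes rows, so the rank formula is applied to the transpose of `X`, whose
    -- column `v` is row `v` of `X`.
    ← rank_compoundMatrix_submatrix_kStar (genericMatrix n).transpose
      (by rwa [compoundMatrix_transpose, Matrix.det_transpose]) v
      (fun i => genericMatrix_apply_ne_zero v i) G,
    compoundMatrix_transpose, ← Matrix.transpose_submatrix, Matrix.rank_transpose]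
  exact ⟨Iff.rfl, Iff.rfl⟩
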